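/- Let $S$ be a real or complex inner product space (pre-Hilbert space). For $A\subseteq S$ put $A^{\perp}=\{x\in S:\langle x,a\rangle=0\ \forall a\in A\}$; a linear subspace $M$ of $S$ is orthogonally closed if $M=M^{\perp\perp}$. A *pre-Hilbert space logic* $(S,\mathcal L)$ is a family $\mathcal L$ of orthogonally closed linear subspaces of $S$ such that $\{0\}\in\mathcal L$, $M^{\perp}\in\mathcal L$ for every $M\in\mathcal L$, and $M+\mathrm{span}\{u\}\in\mathcal L$ for all $M\in\mathcal L$, $u\in S$; it is partially ordered by inclusion. Let $F(S)$ be the logic of all orthogonally closed linear subspaces of $S$. $\mathcal L$ is *atomic $\sigma$-complete* if every sequence of pairwise orthogonal atoms of $\mathcal L$ has a supremum in $\mathcal L$. In a poset $P$, a net $(x_\gamma)_{\gamma\in\Gamma}$ *o-converges* to $x\in P$ if there are nets $(a_\gamma)_{\gamma\in\Gamma}$ and $(b_\gamma)_{\gamma\in\Gamma}$ in $P$ with $a_\gamma\le x_\gamma\le b_\gamma$ for all $\gamma$, $(a_\gamma)$ increasing with supremum $x$ and $(b_\gamma)$ decreasing with infimum $x$. The *order topology* $\tau_o(P)$ is the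 topology whose closed sets are the sets $X\subseteq P$ such that no net in $X$ o-converges to a point outside $X$. A linear subspace $M$ of $S$ is *splitting* if $M\oplus M^{\perp}=S$. Its *orthogonal dimension* is the cardinality of any maximal orthonormal system in $M$, i.e. of any orthonormal set $A\subseteq M$ with $A^{\perp}\cap M=\{0\}$. Let $(S,\mathcal L)$ be a pre-Hilbert space logic such that $S$ is incomplete. (i) If $\mathcal L$ is atomic $\sigma$-complete, then $\tau_o(\mathcal L)$ is not Hausdorff. In particular, $\tau_o(F(S))$ is not Hausdorff. (ii) If $\mathcal L$ contains an incomplete splitting subspace of $S$ whose orthogonal dimension is countable (at most $\aleph_0$), then $\tau_o(\mathcal L)$ is not Hausdorff. -/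

import Mathlib

namespace PreHilbert

section OrderTopology

universe u v

/-- A net `x` indexed by a directed set `Γ` o-converges to `l` if there are nets `a`, `b` with
`a γ ≤ x γ ≤ b γ` for all `γ`, `a` increasing with supremum `l`, and `b` decreasing with
infimum `l`. -/
def OConverges {P : Type u} [PartialOrder P] {Γ : Type v} [Preorder Γ] (x : Γ → P) (l : P) :
    Prop :=
  ∃ a b : Γ → P, (∀ γ, a γ ≤ x γ ∧ x γ ≤ b γ) ∧
    (Monotone a ∧ IsLUB (Set.range a) l) ∧ (Antitone b ∧ IsGLB (Set.range b) l)

/-- A set is o-closed if no net in it o-converges to a point outside of it. The index sets range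
over the universe of `P`; by `IsOClosed.mem_of_oConverges` this covers nets indexed in any
universe. -/
def IsOClosed {P : Type u} [PartialOrder P] (X : Set P) : Prop :=
  ∀ (Γ : Type u) [Preorder Γ] [IsDirectedOrder Γ] [Nonempty Γ] (x : Γ → P) (l : P),
    (∀ γ, x γ ∈ X) → OConverges x l → l ∈ X

theorem IsOClosed.mem_of_oConverges {P : Type u} [PartialOrder P] {X : Set P} (hX : IsOClosed X)
    {Γ : Type v} [Preorder Γ] [IsDirectedOrder Γ] [Nonempty Γ] (x : Γ → P) (l : P)
    (hx : ∀ γ, x γ ∈ X) (h : OConverges x l) : l ∈ X := by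
  obtain ⟨a, b, hab, ⟨ha, hal⟩, hb, hbl⟩ := h
  -- reindex the net by the set of values `(a γ, b γ, x γ)`, preordered by the first two entries
  let f : Γ → P × Pᵒᵈ × P := fun γ => (a γ, OrderDual.toDual (b γ), x γ)
  let Δ : Type u := Set.range f
  let pre : Preorder Δ :=
    Preorder.lift (fun d : Δ => ((d.1.1, d.1.2.1) : P × Pᵒᵈ))
  have ne : Nonempty Δ := ⟨⟨f (Classical.arbitrary Γ), Set.mem_range_self _⟩⟩
  have dir : @IsDirectedOrder Δ pre.toLE := @IsDirected.mk Δ _ <| by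
    rintro ⟨_, γ, rfl⟩ ⟨_, δ, rfl⟩
    obtain ⟨ε, h1, h2⟩ := exists_ge_ge γ δ
    refine ⟨⟨f ε, Set.mem_range_self _⟩, ?_, ?_⟩
    · exact (show (a γ, OrderDual.toDual (b γ)) ≤ (a ε, OrderDual.toDual (b ε)) from
        ⟨ha h1, hb h1⟩)
    · exact (show (a δ, OrderDual.toDual (b δ)) ≤ (a ε, OrderDual.toDual (b ε)) from
        ⟨ha h2, hb h2⟩)
  refine @hX Δ pre dir ne (fun d => d.1.2.2) l ?_
    ⟨fun d => d.1.1, fun d => OrderDual.ofDual d.1.2.1, ?_, ⟨?_, ?_⟩, ?_, ?_⟩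
  · rintro ⟨_, γ, rfl⟩
    exact hx γ
  · rintro ⟨_, γ, rfl⟩
    exact hab γ
  · exact fun d e h => h.1
  · convert hal using 1
    ext p
    constructor
    · rintro ⟨⟨_, γ, rfl⟩, rfl⟩
      exact ⟨γ, rfl⟩
    · rintro ⟨γ, rfl⟩
      exact ⟨⟨f γ, γ, rfl⟩, rfl⟩
  · exact fun d e h => h.2
  · convert hbl using 1
    ext p
    constructor
    · rintro ⟨⟨_, γ, rfl⟩, rfl⟩
      exact ⟨γ, rfl⟩
    · rintro ⟨γ, rfl⟩
      exact ⟨⟨f γ, γ, rfl⟩, rfl⟩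

/-- O-convergence passes to cofinal subnets. -/
theorem OConverges.restrict {P : Type u} [PartialOrder P] {Γ : Type v} [Preorder Γ]
    {x : Γ → P} {l : P} (h : OConverges x l) (C : Set Γ) (hC : ∀ γ, ∃ δ ∈ C, γ ≤ δ) :
    OConverges (fun γ : C => x γ) l := by
  obtain ⟨a, b, hab, ⟨ha, hal⟩, hb, hbl⟩ := h
  refine ⟨fun γ => a γ, fun γ => b γ, fun γ => hab γ, ⟨fun _ _ h => ha h, ?_, ?_⟩,
    fun _ _ h => hb h, ?_, ?_⟩
  · rintro _ ⟨γ, rfl⟩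
    exact hal.1 ⟨γ, rfl⟩
  · intro y hy
    refine hal.2 ?_
    rintro _ ⟨γ, rfl⟩
    obtain ⟨δ, hδ, hγ⟩ := hC γ
    exact (ha hγ).trans (hy ⟨⟨δ, hδ⟩, rfl⟩)
  · rintro _ ⟨γ, rfl⟩
    exact hbl.1 ⟨γ, rfl⟩
  · intro y hy
    refine hbl.2 ?_
    rintro _ ⟨γ, rfl⟩
    obtain ⟨δ, hδ, hγ⟩ := hC γ
    exact le_trans (hy ⟨⟨δ, hδ⟩, rfl⟩) (hb hγ)

theorem IsOClosed.union {P : Type u} [PartialOrder P] {X Y : Set P} (hX : IsOClosed X)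
    (hY : IsOClosed Y) : IsOClosed (X ∪ Y) := by
  intro Γ _ _ _ x l hx h
  have key : ∀ Z : Set P, IsOClosed Z → (∀ γ, ∃ δ, x δ ∈ Z ∧ γ ≤ δ) → l ∈ Z := by
    intro Z hZ hC
    let C : Set Γ := {γ | x γ ∈ Z}
    have : Nonempty C := by
      obtain ⟨δ, hδ, _⟩ := hC (Classical.arbitrary Γ)
      exact ⟨⟨δ, hδ⟩⟩
    have : IsDirectedOrder C := ⟨by
      intro p q
      obtain ⟨ε, h1, h2⟩ := exists_ge_ge p.1 q.1
      obtain ⟨δ, hδ, hε⟩ := hC ε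
      exact ⟨⟨δ, hδ⟩, h1.trans hε, h2.trans hε⟩⟩
    exact hZ C (fun γ : C => x γ) l (fun γ => γ.2) (h.restrict C hC)
  by_cases hC : ∀ γ, ∃ δ, x δ ∈ X ∧ γ ≤ δ
  · exact Or.inl (key X hX hC)
  · push Not at hC
    obtain ⟨γ₀, hγ₀⟩ := hC
    refine Or.inr (key Y hY fun γ => ?_)
    obtain ⟨ε, h1, h2⟩ := exists_ge_ge γ γ₀
    exact ⟨ε, (hx ε).resolve_left fun hε => hγ₀ ε hε h2, h1⟩

/-- The order topology `τ_o(P)`: its closed sets are exactly the o-closed sets. (This is not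
Mathlib's `OrderTopology`, which is generated by open rays.) -/
@[reducible]
def oTopology (P : Type u) [PartialOrder P] : TopologicalSpace P :=
  TopologicalSpace.ofClosed {X : Set P | IsOClosed X}
    (fun Γ _ _ _ _ _ hx _ => (hx (Classical.arbitrary Γ)).elim)
    (fun _ hA Γ _ _ _ x l hx h X hX => hA hX Γ x l (fun γ => hx γ X hX) h)
    (fun _ hX _ hY => IsOClosed.union hX hY)

theorem isClosed_oTopology_iff {P : Type u} [PartialOrder P] (X : Set P) :
    @IsClosed P (oTopology P) X ↔ IsOClosed X := by
  rw [← @isOpen_compl_iff P X (oTopology P)]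
  change IsOClosed Xᶜᶜ ↔ IsOClosed X
  rw [compl_compl]

end OrderTopology

section Logic

variable (𝕜 : Type*) [RCLike 𝕜] (S : Type*) [NormedAddCommGroup S] [InnerProductSpace 𝕜 S]

/-- A pre-Hilbert space logic `(S, 𝓛)`: a family `𝓛` of orthogonally closed linear subspaces of
`S` that contains `{0}` and is closed under `M ↦ Mᗮ` and under `M ↦ M + [u]`, `u ∈ S`. -/
structure Logic where
  carrier : Set (Submodule 𝕜 S)
  orthClosed : ∀ M ∈ carrier, Mᗮᗮ = M
  bot_mem : ⊥ ∈ carrier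
  orthogonal_mem : ∀ M ∈ carrier, Mᗮ ∈ carrier
  sup_span_mem : ∀ M ∈ carrier, ∀ u : S, M ⊔ Submodule.span 𝕜 {u} ∈ carrier

variable {𝕜 S}

instance : SetLike (Logic 𝕜 S) (Submodule 𝕜 S) where
  coe L := L.carrier
  coe_injective L₁ L₂ h := by
    cases L₁
    cases L₂
    congr

/-- `𝓛`, ordered by inclusion, has least element `{0}`. -/
instance (L : Logic 𝕜 S) : OrderBot L where
  bot := ⟨⊥, L.bot_mem⟩
  bot_le M := (bot_le : (⊥ : Submodule 𝕜 S) ≤ M)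

/-- `𝓛` is atomic σ-complete: each sequence of pairwise orthogonal atoms of the poset `𝓛` has a
supremum in `𝓛`. -/
def Logic.IsAtomicSigmaComplete (L : Logic 𝕜 S) : Prop :=
  ∀ a : ℕ → L, (∀ n, IsAtom (a n)) →
    (∀ m n, m ≠ n → (a m : Submodule 𝕜 S) ⟂ (a n : Submodule 𝕜 S)) →
    ∃ s : L, IsLUB (Set.range a) s

/-- If `M` is orthogonally closed, then so is `M + [u]`. -/
theorem orthClosed_sup_span (M : Submodule 𝕜 S) (hM : Mᗮᗮ = M) (u : S) :
    (M ⊔ Submodule.span 𝕜 {u})ᗮᗮ = M ⊔ Submodule.span 𝕜 {u} := by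
  refine le_antisymm ?_ (Submodule.le_orthogonal_orthogonal _)
  by_cases hu : u ∈ M
  · rw [sup_eq_left.2 ((Submodule.span_singleton_le_iff_mem u M).2 hu), hM]
  intro x hx
  obtain ⟨n₀, hn₀, hne⟩ : ∃ n ∈ Mᗮ, inner 𝕜 n u ≠ 0 := by
    by_contra hcon
    push Not at hcon
    exact hu (hM ▸ (Submodule.mem_orthogonal Mᗮ u).2 hcon)
  have hxM : x - (inner 𝕜 n₀ x / inner 𝕜 n₀ u) • u ∈ M := by
    rw [← hM, Submodule.mem_orthogonal]
    intro n hn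
    have hmem : n - (starRingEnd 𝕜 (inner 𝕜 n u / inner 𝕜 n₀ u)) • n₀ ∈
        (M ⊔ Submodule.span 𝕜 {u})ᗮ := by
      rw [← Submodule.inf_orthogonal]
      refine ⟨sub_mem hn (Submodule.smul_mem _ _ hn₀), ?_⟩
      rw [SetLike.mem_coe, Submodule.mem_orthogonal_singleton_iff_inner_left, inner_sub_left,
        inner_smul_left, RCLike.conj_conj, div_mul_cancel₀ _ hne, sub_self]
    have h := (Submodule.mem_orthogonal _ _).1 hx _ hmem
    rw [inner_sub_left, inner_smul_left, RCLike.conj_conj] at h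
    rw [inner_sub_right, inner_smul_right, ← h]
    ring
  have := Submodule.add_mem_sup hxM (Submodule.smul_mem _ (inner 𝕜 n₀ x / inner 𝕜 n₀ u)
    (Submodule.mem_span_singleton_self u))
  simpa using this

variable (𝕜 S)

/-- `F(S)`: the logic of all orthogonally closed linear subspaces of `S`. -/
def orthClosedLogic : Logic 𝕜 S where
  carrier := {M | Mᗮᗮ = M}
  orthClosed _ h := h
  bot_mem := by simp
  orthogonal_mem M h := congrArg Submodule.orthogonal h
  sup_span_mem M h u := orthClosed_sup_span M h u

variable {𝕜 S}

/-- `M` is a splitting subspace of `S`: `S = M ⊕ Mᗮ`. -/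
def IsSplitting (M : Submodule 𝕜 S) : Prop := IsCompl M Mᗮ

/-- `A` is a maximal orthonormal system in the linear subspace `M`: an orthonormal set contained
in `M` such that only the zero vector of `M` is orthogonal to all of `A`. -/
def IsMONS (M : Submodule 𝕜 S) (A : Set S) : Prop :=
  A ⊆ M ∧ Orthonormal 𝕜 (Subtype.val : A → S) ∧
    ∀ x ∈ M, (∀ a ∈ A, inner 𝕜 a x = 0) → x = 0

theorem exists_isMONS (M : Submodule 𝕜 S) : ∃ A : Set S, IsMONS M A := by
  obtain ⟨w, -, hw, hmax⟩ := exists_maximal_orthonormal (𝕜 := 𝕜) (E := M)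
    (s := ∅) ⟨fun i => i.2.elim, fun i => i.2.elim⟩
  refine ⟨Subtype.val '' w, ?_, ?_, ?_⟩
  · rintro _ ⟨a, -, rfl⟩
    exact a.2
  · have h1 := hw.comp_linearIsometry M.subtypeₗᵢ
    have h2 := h1.toSubtypeRange
    convert h2 using 2
    · simp [Set.range_comp]
    · simp [Set.range_comp]
  · intro x hxM hx
    have hbot := (maximal_orthonormal_iff_orthogonalComplement_eq_bot hw).1
      fun u hu hon => (hmax u hu hon).symm ▸ rfl
    have hmem : (⟨x, hxM⟩ : M) ∈ (Submodule.span 𝕜 w)ᗮ := by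
      rw [Submodule.mem_orthogonal]
      intro y hy
      induction hy using Submodule.span_induction with
      | mem y hy => exact hx y ⟨y, hy, rfl⟩
      | zero => simp
      | add y z _ _ h1 h2 => rw [inner_add_left, h1, h2, add_zero]
      | smul c y _ h => rw [inner_smul_left, h, mul_zero]
    rw [hbot, Submodule.mem_bot] at hmem
    exact congrArg Subtype.val hmem

/-- The orthogonal dimension `dim M`: the cardinality of a maximal orthonormal system in `M`.
All of them have the same cardinality. -/
noncomputable def orthDim (M : Submodule 𝕜 S) : Cardinal :=
  Cardinal.mk ↥(Classical.choose (exists_isMONS M))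

end Logic

end PreHilbert

/-! Let `H` be the completion of `S`, and let `D` be a subspace of `S` that has an adherent vector
`v` in `H` outside `S`. Let `V` be an o-open set containing a finite-dimensional `y`. The spaces
`Gᗮ`, with `G` finite-dimensional and orthogonal to `y` and `v`, decrease to `y`: only `y + [v]` is
orthogonal to all these `G`, and it meets `S` in `y`. Yet each `Gᗮ` contains vectors `u` of `D`
close to `v`, and `y ≤ y + [u] ≤ Gᗮ`; so the `y + [u]` o-converge to `y` and one of them lies in `V`
(`Logic.exists_sup_span_mem`). Replacing `v` by `d + c • v` with `c` small makes `u` approximate any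
given `d` in `D`.

If `D` is countably generated, iterating from `{0}` gives an increasing sequence in `V` whose
members together approximate all generators. Its supremum is `Dᗮᗮ`, so `{0}` and `Dᗮᗮ` cannot be
separated (`Logic.not_t2Space_of_span_range`).

It remains to find such a `D` with `Dᗮᗮ ∈ 𝓛`: the span of a non-convergent Cauchy sequence in (i),
the span of a maximal orthonormal system of the incomplete splitting subspace in (ii). -/

namespace PreHilbert

variable {𝕜 : Type*} [RCLike 𝕜]

/-! ### Dense subspaces and finite codimension -/

section Density

variable {H : Type*} [NormedAddCommGroup H] [InnerProductSpace 𝕜 H]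

/-- A vector adherent to a subspace `D` and orthogonal to a finite-dimensional subspace `G` is
adherent to `D ⊓ Gᗮ`. -/
theorem mem_closure_inf_orthogonal (D G : Submodule 𝕜 H) [FiniteDimensional 𝕜 G] {v : H}
    (hv : v ∈ closure (D : Set H)) (hvG : v ∈ Gᗮ) :
    v ∈ closure ((D ⊓ Gᗮ : Submodule 𝕜 H) : Set H) := by
  let P : H →L[𝕜] G := G.orthogonalProjectionOnto
  let p : D →ₗ[𝕜] G := P.toLinearMap ∘ₗ D.subtype
  -- With `s` a linear right inverse of `P` on `P(D)`, the map `x ↦ x - s (P x)` sends `D` into `D ⊓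
  -- Gᗮ`. It is continuous because `G` is finite-dimensional, and it fixes `v` because `P v = 0`.
  obtain ⟨s₀, hs₀⟩ := p.rangeRestrict.exists_rightInverse_of_surjective p.range_rangeRestrict
  obtain ⟨s, hs⟩ := LinearMap.exists_extend s₀
  have hps : ∀ d : D, p (s (p d)) = p d := by
    intro d
    have h1 : s (p d) = s₀ (p.rangeRestrict d) := by
      rw [← hs]
      rfl
    have h2 : p.rangeRestrict (s₀ (p.rangeRestrict d)) = p.rangeRestrict d :=
      LinearMap.congr_fun hs₀ (p.rangeRestrict d)
    rw [h1]
    exact congrArg Subtype.val h2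
  have hcont : Continuous fun x : H => x - (s (P x) : H) :=
    continuous_id.sub ((LinearMap.continuous_of_finiteDimensional (D.subtype ∘ₗ s)).comp
      P.continuous)
  have hPv : P v = 0 := G.orthogonalProjectionOnto_apply_of_mem_orthogonal hvG
  have := map_mem_closure hcont hv (t := ((D ⊓ Gᗮ : Submodule 𝕜 H) : Set H)) fun d hd => by
    refine ⟨sub_mem hd (s (P d)).2, ?_⟩
    have h : P (d - (s (P d) : H)) = 0 := by
      rw [map_sub, sub_eq_zero]
      exact (hps ⟨d, hd⟩).symm
    exact Submodule.orthogonalProjectionOnto_eq_zero_iff.1 h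
  simpa [hPv] using this

end Density

variable {S : Type*} [NormedAddCommGroup S] [InnerProductSpace 𝕜 S]

theorem Logic.mem_of_finiteDimensional (L : Logic 𝕜 S) (M : Submodule 𝕜 S)
    [FiniteDimensional 𝕜 M] : M ∈ L := by
  classical
  obtain ⟨s, rfl⟩ : M.FG := Module.Finite.iff_fg.1 inferInstance
  suffices ∀ s : Finset S, Submodule.span 𝕜 (s : Set S) ∈ L from this s
  intro s
  induction s using Finset.induction with
  | empty =>
    rw [Finset.coe_empty, Submodule.span_empty]
    exact L.bot_mem
  | insert a s _ ih =>
    rw [Finset.coe_insert, Submodule.span_insert, sup_comm]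
    exact L.sup_span_mem _ ih a

theorem Logic.isClosed_coe (L : Logic 𝕜 S) (M : L) : IsClosed ((M : Submodule 𝕜 S) : Set S) := by
  rw [← L.orthClosed M M.2]
  exact Submodule.isClosed_orthogonal _

/-! ### Inseparable points from a subspace whose closure leaves `S` -/

section Completion

variable {H : Type*} [NormedAddCommGroup H] [InnerProductSpace 𝕜 H] (ι : S →ₗᵢ[𝕜] H)

/-- The finite-codimensional subspaces `Gᗮ` of a dense subspace `S`, with `G` orthogonal to `y`
and to a vector `v` outside of `S`, intersect in `y`. -/
theorem mem_of_forall_inner_eq_zero (hι : DenseRange ι) (y : Submodule 𝕜 S)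
    [FiniteDimensional 𝕜 y] {v : H} (hv : v ∉ Set.range ι) {x : S}
    (hx : ∀ g ∈ yᗮ, inner 𝕜 v (ι g) = 0 → inner 𝕜 g x = 0) : x ∈ y := by
  -- The hypothesis says that `ι x` is orthogonal to `S ∩ Mᗮ`, which is dense in `Mᗮ`; hence `ι x ∈
  -- Mᗮᗮ = M`. A nonzero `v`-component would put `v` in `S`.
  let M : Submodule 𝕜 H := y.map ι.toLinearMap ⊔ Submodule.span 𝕜 {v}
  have hxM : ι x ∈ Mᗮᗮ := by
    rw [Submodule.mem_orthogonal]
    intro w hw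
    have hwc := mem_closure_inf_orthogonal (LinearMap.range ι.toLinearMap) M (v := w)
      (hι w) hw
    have hsub : ((LinearMap.range ι.toLinearMap ⊓ Mᗮ : Submodule 𝕜 H) : Set H) ⊆
        {z | inner 𝕜 z (ι x) = 0} := by
      rintro _ ⟨⟨g, rfl⟩, hg⟩
      have hg' := (Submodule.mem_orthogonal _ _).1 hg
      refine (ι.inner_map_map g x).trans (hx g ?_ ?_)
      · rw [Submodule.mem_orthogonal]
        intro z hz
        rw [← ι.inner_map_map]
        exact hg' _ (Submodule.mem_sup_left ⟨z, hz, rfl⟩)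
      · exact hg' _ (Submodule.mem_sup_right (Submodule.mem_span_singleton_self v))
    exact closure_minimal hsub
      (isClosed_eq (continuous_id.inner continuous_const) continuous_const) hwc
  rw [Submodule.orthogonal_orthogonal] at hxM
  obtain ⟨_, ⟨z, hz, rfl⟩, _, hc, hzc⟩ := Submodule.mem_sup.1 hxM
  obtain ⟨c, rfl⟩ := Submodule.mem_span_singleton.1 hc
  have hzc : ι z + c • v = ι x := hzc
  by_cases hc0 : c = 0
  · have : z = x := ι.injective (by simpa [hc0] using hzc)
    exact this ▸ hz
  · refine absurd ⟨c⁻¹ • (x - z), ?_⟩ hv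
    rw [map_smul, map_sub, ← hzc, add_sub_cancel_left, inv_smul_smul₀ hc0]

/-- Every o-open set that contains a finite-dimensional `y` also contains some `y + [u]` with `u`
close to a prescribed vector of the completion lying outside of `S`. -/
theorem Logic.exists_sup_span_mem (hι : DenseRange ι) (L : Logic 𝕜 S) {V : Set L}
    (hV : IsOClosed Vᶜ) (y : L) [FiniteDimensional 𝕜 (y : Submodule 𝕜 S)] (hy : y ∈ V)
    (D : Submodule 𝕜 S) {v : H} (hvD : v ∈ closure (ι '' (D : Set S)))
    (hv : v ∉ Set.range ι) {ε : ℝ} (hε : 0 < ε) :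
    ∃ u ∈ D, dist (ι u) v < ε ∧
      (⟨y ⊔ Submodule.span 𝕜 {u}, L.sup_span_mem y y.2 u⟩ : L) ∈ V := by
  by_contra! hcon
  let Γ : Type _ := {G : Submodule 𝕜 S // FiniteDimensional 𝕜 G ∧ G ≤ (y : Submodule 𝕜 S)ᗮ ∧
    ∀ g ∈ G, inner 𝕜 v (ι g) = 0}
  have : Nonempty Γ := ⟨⟨⊥, inferInstance, bot_le, by simp⟩⟩
  have : IsDirectedOrder Γ := ⟨by
    rintro ⟨G₁, _, h1, h1v⟩ ⟨G₂, _, h2, h2v⟩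
    refine ⟨⟨G₁ ⊔ G₂, inferInstance, sup_le h1 h2, ?_⟩,
      (le_sup_left : G₁ ≤ G₁ ⊔ G₂), (le_sup_right : G₂ ≤ G₁ ⊔ G₂)⟩
    intro g hg
    obtain ⟨g₁, hg₁, g₂, hg₂, rfl⟩ := Submodule.mem_sup.1 hg
    rw [map_add, inner_add_right, h1v _ hg₁, h2v _ hg₂, add_zero]⟩
  -- Since `v` is orthogonal to `G`, the approximants of `v` in `D` can be taken orthogonal to `G`
  -- too.
  have hu : ∀ G : Γ, ∃ u ∈ D, dist (ι u) v < ε ∧ u ∈ (G : Submodule 𝕜 S)ᗮ := by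
    rintro ⟨G, _, -, hGv⟩
    have hvG : v ∈ (G.map ι.toLinearMap)ᗮ := by
      rw [Submodule.mem_orthogonal']
      rintro _ ⟨g, hg, rfl⟩
      exact hGv g hg
    have hcl := mem_closure_inf_orthogonal (D.map ι.toLinearMap) (G.map ι.toLinearMap) hvD hvG
    obtain ⟨_, ⟨⟨u, huD, rfl⟩, huG⟩, hdist⟩ := Metric.mem_closure_iff.1 hcl ε hε
    refine ⟨u, huD, by rwa [dist_comm], ?_⟩
    rw [Submodule.mem_orthogonal]
    intro g hg
    rw [← ι.inner_map_map]
    exact (Submodule.mem_orthogonal _ _).1 huG _ ⟨g, hg, rfl⟩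
  choose u huD huv huG using hu
  have hmem (G : Γ) : (G : Submodule 𝕜 S)ᗮ ∈ L :=
    have := G.2.1
    L.orthogonal_mem _ (L.mem_of_finiteDimensional (G : Submodule 𝕜 S))
  have hyG (G : Γ) : (y : Submodule 𝕜 S) ≤ (G : Submodule 𝕜 S)ᗮ :=
    (Submodule.le_orthogonal_orthogonal _).trans (Submodule.orthogonal_le G.2.2.1)
  refine hV.mem_of_oConverges
    (fun G : Γ => (⟨y ⊔ Submodule.span 𝕜 {u G}, L.sup_span_mem y y.2 (u G)⟩ : L)) y
    (fun G => hcon _ (huD G) (huv G))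
    ⟨fun _ => y, fun G => ⟨(G : Submodule 𝕜 S)ᗮ, hmem G⟩, fun G => ⟨?_, ?_⟩,
      ⟨monotone_const, by simp [isLUB_singleton]⟩, ?_, ?_, ?_⟩ hy
  · exact (le_sup_left : (y : Submodule 𝕜 S) ≤ _)
  · exact sup_le (hyG G) ((Submodule.span_singleton_le_iff_mem _ _).2 (huG G))
  · exact fun G₁ G₂ h => Submodule.orthogonal_le h
  · rintro _ ⟨G, rfl⟩
    exact hyG G
  · intro z hz x hx
    refine mem_of_forall_inner_eq_zero ι hι y hv fun g hg hgv => ?_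
    -- One-dimensional `G` already force the infimum down to `y`.
    have hG : ∀ g' ∈ Submodule.span 𝕜 {g}, inner 𝕜 v (ι g') = 0 := by
      intro g' hg'
      obtain ⟨c, rfl⟩ := Submodule.mem_span_singleton.1 hg'
      rw [map_smul, inner_smul_right, hgv, mul_zero]
    have hzG := hz ⟨(⟨Submodule.span 𝕜 {g}, inferInstance,
      (Submodule.span_singleton_le_iff_mem _ _).2 hg, hG⟩ : Γ), rfl⟩
    exact (Submodule.mem_orthogonal _ _).1 (hzG hx) g (Submodule.mem_span_singleton_self g)

/-- Every o-open set that contains a finite-dimensional `y` also contains some `y + [u]` with `u`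
close to a prescribed vector of `D`, if the closure of `D` in the completion is not contained
in `S`. -/
theorem Logic.exists_sup_span_mem_of_mem (hι : DenseRange ι) (L : Logic 𝕜 S) {V : Set L}
    (hV : IsOClosed Vᶜ) (y : L) [FiniteDimensional 𝕜 (y : Submodule 𝕜 S)] (hy : y ∈ V)
    (D : Submodule 𝕜 S) (hD : ¬ closure (ι '' (D : Set S)) ⊆ Set.range ι)
    {d : S} (hd : d ∈ D) {ε : ℝ} (hε : 0 < ε) :
    ∃ u ∈ D, dist u d < ε ∧
      (⟨y ⊔ Submodule.span 𝕜 {u}, L.sup_span_mem y y.2 u⟩ : L) ∈ V := by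
  obtain ⟨v, hvD, hv⟩ := Set.not_subset.1 hD
  have hv0 : v ≠ 0 := fun h => hv ⟨0, by simp [h]⟩
  have hn : 0 < ‖v‖ := norm_pos_iff.2 hv0
  -- The target `ι d + c • v` is still adherent to `D` and outside `S`, at distance `ε / 2` from `ι
  -- d`.
  let c : 𝕜 := ((ε / 2 / ‖v‖ : ℝ) : 𝕜)
  have hc : c ≠ 0 := RCLike.ofReal_ne_zero.2 (by positivity)
  have hcv : ‖c • v‖ = ε / 2 := by
    rw [norm_smul, RCLike.norm_ofReal, abs_of_pos (by positivity), div_mul_cancel₀ _ hn.ne']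
  let E : Submodule 𝕜 H := (D.map ι.toLinearMap).topologicalClosure
  have hw : ι d + c • v ∈ E :=
    E.add_mem (Submodule.le_topologicalClosure _ ⟨d, hd, rfl⟩) (E.smul_mem c hvD)
  have hw' : ι d + c • v ∉ Set.range ι := by
    rintro ⟨x, hx⟩
    refine hv ⟨c⁻¹ • (x - d), ?_⟩
    rw [map_smul, map_sub, hx, add_sub_cancel_left, inv_smul_smul₀ hc]
  obtain ⟨u, huD, hu, huV⟩ := L.exists_sup_span_mem ι hι hV y hy D hw hw' (half_pos hε)
  refine ⟨u, huD, ?_, huV⟩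
  rw [← ι.dist_map]
  calc dist (ι u) (ι d) ≤ dist (ι u) (ι d + c • v) + dist (ι d + c • v) (ι d) :=
        dist_triangle _ _ _
    _ < ε / 2 + ε / 2 := by
        rw [dist_self_add_left, hcv]
        linarith
    _ = ε := add_halves ε

/-- If `D` is countably generated, its closure in the completion is not contained in `S`, and
`Dᗮᗮ ∈ 𝓛`, then `{0}` and `Dᗮᗮ` have no disjoint neighbourhoods. -/
theorem Logic.not_t2Space_of_span_range (hι : DenseRange ι) (L : Logic 𝕜 S) (d : ℕ → S)
    (hD : ¬ closure (ι '' (Submodule.span 𝕜 (Set.range d) : Set S)) ⊆ Set.range ι)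
    (hL : (Submodule.span 𝕜 (Set.range d))ᗮᗮ ∈ L) : ¬ @T2Space L (oTopology L) := by
  intro hT2
  let τ := oTopology L
  set D := Submodule.span 𝕜 (Set.range d) with hDdef
  have hdD (n : ℕ) : d n ∈ D := Submodule.subset_span ⟨n, rfl⟩
  let s : L := ⟨Dᗮᗮ, hL⟩
  have hne : (⊥ : L) ≠ s := by
    intro h
    have hs : Dᗮᗮ = ⊥ := (congrArg Subtype.val h).symm
    have hDb : D = ⊥ := eq_bot_iff.2 (hs ▸ D.le_orthogonal_orthogonal)
    refine hD ?_
    rw [hDb]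
    simpa using ⟨0, map_zero ι⟩
  obtain ⟨V, W, hV, hW, hbV, hsW, hVW⟩ := hT2.t2 hne
  have hVc : IsOClosed Vᶜ := (isClosed_oTopology_iff _).1 hV.isClosed_compl
  have hWc : IsOClosed Wᶜ := (isClosed_oTopology_iff _).1 hW.isClosed_compl
  let T : Type _ := {M : L // FiniteDimensional 𝕜 (M : Submodule 𝕜 S) ∧ M ∈ V ∧
    (M : Submodule 𝕜 S) ≤ D}
  -- Stage `n = Nat.pair j k` handles the generator `d j` with precision `1 / (k + 1)`, so each
  -- generator is approximated to every precision.
  have step (n : ℕ) (M : T) : ∃ M' : T, M ≤ M' ∧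
      ∃ u ∈ (M'.1 : Submodule 𝕜 S), dist u (d n.unpair.1) < 1 / ((n.unpair.2 : ℝ) + 1) := by
    obtain ⟨M, _, hMV, hMD⟩ := M
    obtain ⟨u, huD, hu, huV⟩ := L.exists_sup_span_mem_of_mem ι hι hVc M hMV D hD
      (hdD n.unpair.1) (Nat.one_div_pos_of_nat (α := ℝ) (n := n.unpair.2))
    refine ⟨⟨⟨M ⊔ Submodule.span 𝕜 {u}, L.sup_span_mem M M.2 u⟩,
      inferInstanceAs (FiniteDimensional 𝕜
        ((M : Submodule 𝕜 S) ⊔ Submodule.span 𝕜 {u} : Submodule 𝕜 S)), huV,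
      sup_le hMD ((Submodule.span_singleton_le_iff_mem _ _).2 huD)⟩, ?_, u,
      Submodule.mem_sup_right (Submodule.mem_span_singleton_self u), hu⟩
    exact (le_sup_left : (M : Submodule 𝕜 S) ≤ (M : Submodule 𝕜 S) ⊔ Submodule.span 𝕜 {u})
  choose next hle u huM hu using step
  let F : ℕ → T := fun n => Nat.rec
    ⟨⊥, inferInstanceAs (FiniteDimensional 𝕜 (⊥ : Submodule 𝕜 S)), hbV,
      (bot_le : (⊥ : Submodule 𝕜 S) ≤ D)⟩ next n
  have hF : Monotone F := monotone_nat_of_le_succ fun n => hle n (F n)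
  have hlub : IsLUB (Set.range fun n => (F n).1) s := by
    constructor
    · rintro _ ⟨n, rfl⟩
      exact (F n).2.2.2.trans D.le_orthogonal_orthogonal
    · intro M hM
      have huM' (n : ℕ) : u n (F n) ∈ (M : Submodule 𝕜 S) :=
        hM ⟨n + 1, rfl⟩ (huM n (F n))
      -- Members of `𝓛` are norm closed, so an upper bound containing all the approximants contains
      -- the generators themselves.
      have hDM : D ≤ M := by
        rw [hDdef, Submodule.span_le]
        rintro _ ⟨j, rfl⟩
        rw [← (L.isClosed_coe M).closure_eq, Metric.mem_closure_iff]
        intro ε hε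
        obtain ⟨k, hk⟩ := exists_nat_one_div_lt hε
        refine ⟨_, huM' (Nat.pair j k), ?_⟩
        have := hu (Nat.pair j k) (F (Nat.pair j k))
        rw [Nat.unpair_pair] at this
        rw [dist_comm]
        exact this.trans hk
      change Dᗮᗮ ≤ (M : Submodule 𝕜 S)
      rw [← L.orthClosed M M.2]
      exact Submodule.orthogonal_orthogonal_monotone hDM
  refine hWc.mem_of_oConverges (fun n => (F n).1) s
    (fun n => Set.disjoint_left.1 hVW (F n).2.2.1)
    ⟨fun n => (F n).1, fun _ => s, fun n => ⟨le_rfl, hlub.1 ⟨n, rfl⟩⟩,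
      ⟨fun _ _ h => hF h, hlub⟩, antitone_const, by simp [isGLB_singleton]⟩ hsW

end Completion

/-! ### Incompleteness and closures in the completion -/

section Incomplete

variable {H : Type*} [NormedAddCommGroup H] [InnerProductSpace 𝕜 H] [CompleteSpace H]
  (ι : S →ₗᵢ[𝕜] H)

theorem isComplete_closure_of_subset_range {A : Set S}
    (h : closure (ι '' A) ⊆ Set.range ι) : IsComplete (closure A) := by
  rw [← isComplete_image_iff ι.isometry.isUniformInducing,
    ι.isometry.isUniformInducing.isInducing.closure_eq_preimage_closure_image,
    Set.image_preimage_eq_of_subset h]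
  exact isClosed_closure.isComplete

/-- A Cauchy sequence without limit in `S` serves as `d`: if the closure of its span in `H` stayed
in `S`, the closure in `S` would be complete and the sequence would converge. -/
theorem exists_seq_closure_span_not_subset (hS : ¬ CompleteSpace S) :
    ∃ d : ℕ → S,
      ¬ closure (ι '' (Submodule.span 𝕜 (Set.range d) : Set S)) ⊆ Set.range ι := by
  by_contra! hcon
  refine hS (Metric.complete_of_cauchySeq_tendsto fun d hd => ?_)
  obtain ⟨x, -, hx⟩ := cauchySeq_tendsto_of_isComplete
    (isComplete_closure_of_subset_range ι (hcon d))
    (fun n => subset_closure (Submodule.subset_span ⟨n, rfl⟩)) hd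
  exact ⟨x, hx⟩

end Incomplete

/-! ### Atoms and suprema in an atomic σ-complete logic -/

theorem isAtom_span_singleton (L : Logic 𝕜 S) {x : S} (hx : x ≠ 0) :
    IsAtom (⟨Submodule.span 𝕜 {x}, L.mem_of_finiteDimensional _⟩ : L) := by
  have hatom := nonzero_span_atom (K := 𝕜) x hx
  refine ⟨fun h => hatom.1 (congrArg Subtype.val h), fun M hM => Subtype.ext ?_⟩
  exact hatom.2 M hM

/-- The supremum in `𝓛` of one-dimensional subspaces is the biorthogonal of their span. -/
theorem Logic.eq_orthogonal_orthogonal_of_isLUB (L : Logic 𝕜 S) {κ : Type*} (e : κ → S) {s : L}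
    (hs : IsLUB (Set.range fun i =>
      (⟨Submodule.span 𝕜 {e i}, L.mem_of_finiteDimensional _⟩ : L)) s) :
    (s : Submodule 𝕜 S) = (Submodule.span 𝕜 (Set.range e))ᗮᗮ := by
  apply le_antisymm
  · intro z hz
    rw [Submodule.mem_orthogonal]
    intro x hx
    -- The hyperplane `[x]ᗮ` belongs to every logic, so it is an admissible upper bound;
    -- intersecting over all such `x` gives the biorthogonal.
    have hle : s ≤ ⟨(Submodule.span 𝕜 {x})ᗮ,
        L.orthogonal_mem _ (L.mem_of_finiteDimensional (Submodule.span 𝕜 {x}))⟩ := by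
      refine hs.2 ?_
      rintro _ ⟨i, rfl⟩
      change Submodule.span 𝕜 {e i} ≤ (Submodule.span 𝕜 {x})ᗮ
      rw [Submodule.span_singleton_le_iff_mem, Submodule.mem_orthogonal_singleton_iff_inner_left]
      exact (Submodule.mem_orthogonal _ _).1 hx _ (Submodule.subset_span ⟨i, rfl⟩)
    exact Submodule.mem_orthogonal_singleton_iff_inner_right.1 (hle hz)
  · rw [← L.orthClosed s s.2]
    refine Submodule.orthogonal_orthogonal_monotone (Submodule.span_le.2 ?_)
    rintro _ ⟨i, rfl⟩
    exact hs.1 ⟨i, rfl⟩ (Submodule.mem_span_singleton_self (e i))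

/-- An atomic σ-complete logic contains the biorthogonal of every sequence of vectors. -/
theorem Logic.IsAtomicSigmaComplete.orthogonal_orthogonal_mem {L : Logic 𝕜 S}
    (hL : L.IsAtomicSigmaComplete) (d : ℕ → S) :
    (Submodule.span 𝕜 (Set.range d))ᗮᗮ ∈ L := by
  -- Zero Gram–Schmidt vectors do not span atoms and are discarded. If infinitely many remain, they
  -- are reindexed by `ℕ` to give the sequence of atoms; otherwise the span is finite-dimensional.
  let N : Set ℕ := {n | InnerProductSpace.gramSchmidt 𝕜 d n ≠ 0}
  have hspan : Submodule.span 𝕜 (InnerProductSpace.gramSchmidt 𝕜 d '' N) =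
      Submodule.span 𝕜 (Set.range d) := by
    rw [← InnerProductSpace.span_gramSchmidt]
    refine le_antisymm (Submodule.span_mono (Set.image_subset_range _ _)) (Submodule.span_le.2 ?_)
    rintro _ ⟨n, rfl⟩
    by_cases hn : InnerProductSpace.gramSchmidt 𝕜 d n = 0
    · rw [hn]
      exact zero_mem _
    · exact Submodule.subset_span ⟨n, hn, rfl⟩
  rcases N.finite_or_infinite with hN | hN
  · have : FiniteDimensional 𝕜 (Submodule.span 𝕜 (Set.range d)) := by
      rw [← hspan]
      exact FiniteDimensional.span_of_finite 𝕜 (hN.image _)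
    exact L.orthogonal_mem _ (L.orthogonal_mem _ (L.mem_of_finiteDimensional _))
  · have : Infinite N := hN.to_subtype
    classical
    let φ := Nat.orderEmbeddingOfSet N
    have hφ : Set.range φ = N := Nat.orderEmbeddingOfSet_range N
    let e : ℕ → S := fun n => InnerProductSpace.gramSchmidt 𝕜 d (φ n)
    have he : Set.range e = InnerProductSpace.gramSchmidt 𝕜 d '' N := by
      rw [← hφ, ← Set.range_comp]
      rfl
    obtain ⟨s, hs⟩ := hL (fun n => ⟨Submodule.span 𝕜 {e n}, L.mem_of_finiteDimensional _⟩)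
      (fun n => isAtom_span_singleton L (hφ.le ⟨n, rfl⟩)) fun m n hmn => by
        rw [Submodule.isOrtho_span]
        rintro _ rfl _ rfl
        exact InnerProductSpace.gramSchmidt_orthogonal 𝕜 d (φ.injective.ne hmn)
    rw [← hspan, ← he, ← L.eq_orthogonal_orthogonal_of_isLUB e hs]
    exact s.2

/-! ### Incomplete splitting subspaces of countable dimension -/

/-- A maximal orthonormal system of a splitting subspace has the same orthogonal complement. -/
theorem IsMONS.orthogonal_span {U : Submodule 𝕜 S} {A : Set S} (hA : IsMONS U A)
    (hU : IsSplitting U) : (Submodule.span 𝕜 A)ᗮ = Uᗮ := by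
  refine le_antisymm (fun x hx => ?_) (Submodule.orthogonal_le (Submodule.span_le.2 hA.1))
  obtain ⟨y, hy, z, hz, rfl⟩ := Submodule.mem_sup.1 (hU.sup_eq_top ▸ Submodule.mem_top (x := x))
  have hy0 : y = 0 := by
    refine hA.2.2 y hy fun a ha => ?_
    have h := (Submodule.mem_orthogonal _ _).1 hx a (Submodule.subset_span ha)
    rwa [inner_add_right, (Submodule.mem_orthogonal _ _).1 hz a (hA.1 ha), add_zero] at h
  rwa [hy0, zero_add]

/-- For `D` the span of a maximal orthonormal system, splitting gives `Dᗮᗮ = U`. If the closure of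
`D` in `H` stayed in `S`, the closure in `S` would be complete, hence equal to `Dᗮᗮ = U`, against
the incompleteness of `U`. -/
theorem Logic.not_t2Space_of_isSplitting (L : Logic 𝕜 S) {U : Submodule 𝕜 S} (hUL : U ∈ L)
    (hU : IsSplitting U) (hUc : ¬ IsComplete (U : Set S)) (hdim : orthDim U ≤ Cardinal.aleph0) :
    ¬ @T2Space L (oTopology L) := by
  let ι : S →ₗᵢ[𝕜] UniformSpace.Completion S := UniformSpace.Completion.toComplₗᵢ
  let A : Set S := Classical.choose (exists_isMONS U)
  have hA : IsMONS U A := Classical.choose_spec (exists_isMONS U)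
  -- Adding `0` makes the set nonempty, as an enumeration by `ℕ` requires, without changing its
  -- span.
  have hAc : (insert 0 A).Countable := (Cardinal.le_aleph0_iff_set_countable.1 hdim).insert 0
  obtain ⟨d, hd⟩ := hAc.exists_eq_range (Set.insert_nonempty 0 A)
  have hspan : Submodule.span 𝕜 (Set.range d) = Submodule.span 𝕜 A := by
    rw [← hd, Submodule.span_insert_zero]
  have hUU : (Submodule.span 𝕜 A)ᗮᗮ = U := by
    rw [hA.orthogonal_span hU, L.orthClosed U hUL]
  refine L.not_t2Space_of_span_range ι UniformSpace.Completion.denseRange_coe d ?_ ?_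
  · intro hsub
    rw [hspan] at hsub
    have hc : IsComplete ((Submodule.span 𝕜 A).topologicalClosure : Set S) :=
      isComplete_closure_of_subset_range ι hsub
    have : CompleteSpace (Submodule.span 𝕜 A).topologicalClosure := hc.completeSpace_coe
    have hK : (Submodule.span 𝕜 A).topologicalClosure = U := by
      rw [← hUU, ← Submodule.orthogonal_closure (Submodule.span 𝕜 A),
        Submodule.orthogonal_orthogonal]
    exact hUc (hK ▸ hc)
  · rwa [hspan, hUU]

end PreHilbert

theorem corollary25 {𝕜 : Type*} [RCLike 𝕜] {S : Type*} [NormedAddCommGroup S]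
    [InnerProductSpace 𝕜 S] (hS : ¬ CompleteSpace S) :
    (∀ L : PreHilbert.Logic 𝕜 S, L.IsAtomicSigmaComplete →
      ¬ @T2Space L (PreHilbert.oTopology L)) ∧
    ¬ @T2Space (PreHilbert.orthClosedLogic 𝕜 S)
      (PreHilbert.oTopology (PreHilbert.orthClosedLogic 𝕜 S)) ∧
    (∀ L : PreHilbert.Logic 𝕜 S,
      (∃ U ∈ L, PreHilbert.IsSplitting U ∧ ¬ IsComplete (U : Set S) ∧
        PreHilbert.orthDim U ≤ Cardinal.aleph0) →
      ¬ @T2Space L (PreHilbert.oTopology L)) := by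
  let ι : S →ₗᵢ[𝕜] UniformSpace.Completion S := UniformSpace.Completion.toComplₗᵢ
  have hι : DenseRange ι := UniformSpace.Completion.denseRange_coe
  obtain ⟨d, hd⟩ := PreHilbert.exists_seq_closure_span_not_subset ι hS
  refine ⟨fun L hL => ?_, ?_, ?_⟩
  · exact L.not_t2Space_of_span_range ι hι d hd (hL.orthogonal_orthogonal_mem d)
  · refine PreHilbert.Logic.not_t2Space_of_span_range ι hι _ d hd ?_
    exact congrArg Submodule.orthogonal
      (Submodule.span 𝕜 (Set.range d)).triorthogonal_eq_orthogonal
  · rintro L ⟨U, hUL, hU, hUc, hdim⟩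
    exact L.not_t2Space_of_isSplitting hUL hU hUc hdim
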